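/- Let $(\Omega,\mathcal A,\mathsf P)$ be a probability space and let $\{\varepsilon_{k,\ell}:k,\ell\ge 1\}$ be independent (not necessarily identically distributed) random variables with $\mathsf E\,\varepsilon_{k,\ell}=0$ and $\mathrm{Var}\,\varepsilon_{k,\ell}=1$. For $\alpha,\beta,\gamma\in\mathbb R$ let $X_{k,\ell}$, $k,\ell\ge 0$ integers, be defined by $$X_{k,\ell}=\alpha X_{k-1,\ell}+\beta X_{k,\ell-1}+\gamma X_{k-1,\ell-1}+\varepsilon_{k,\ell}\quad (k,\ell\ge 1),\qquad X_{k,0}=X_{0,\ell}=0\quad (k,\ell\ge 0).$$ Write $x\wedge y=\min\{x,y\}$ and $0^0=1$. Then for all integers $k_1,\ell_1,k_2,\ell_2\ge 0$ the following hold. 1. If $|\alpha|+|\beta|+|\gamma|<1$, then $$|\mathrm{Cov}(X_{k_1,\ell_1},X_{k_2,\ell_2})|\le\frac{(|\alpha|+|\beta|+|\gamma|)^{(|k_1-k_2|+|\ell_1-\ell_2|)/2}}{\big(1-(|\alpha|+|\beta|+|\gamma|)\big)^2}.$$ 2. If $|\alpha|<1$, $|\beta|<1$, $|\gamma|<1$,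 and $|\alpha|+|\beta|+|\gamma|=1$ in case $\alpha\beta\gamma\ge 0$, while $|\alpha|+|\beta|-|\gamma|=1$ in case $\alpha\beta\gamma<0$, then $$|\mathrm{Cov}(X_{k_1,\ell_1},X_{k_2,\ell_2})|\le C(\alpha,\beta)\sqrt{k_1+\ell_1+k_2+\ell_2}$$ with a constant $C(\alpha,\beta)>0$ depending only on $\alpha$ and $\beta$. 3. If $\alpha\beta\gamma\le 0$ and $|\alpha|=1$, $|\beta|=|\gamma|<1$, then $$|\mathrm{Cov}(X_{k_1,\ell_1},X_{k_2,\ell_2})|\le (k_1\wedge k_2)\,\frac{|\gamma|^{|\ell_1-\ell_2|}}{1-\gamma^2};$$ if $\alpha\beta\gamma\le 0$ and $|\beta|=1$, $|\alpha|=|\gamma|<1$, then $$|\mathrm{Cov}(X_{k_1,\ell_1},X_{k_2,\ell_2})|\le (\ell_1\wedge \ell_2)\,\frac{|\gamma|^{|k_1-k_2|}}{1-\gamma^2}.$$ 4. If $\alpha\beta\gamma=-1$ and $|\alpha|=|\beta|=|\gamma|=1$, then $$\mathrm{Cov}(X_{k_1,\ell_1},X_{k_2,\ell_2})=(k_1\wedge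 k_2)(\ell_1\wedge \ell_2)\,\alpha^{|k_1-k_2|}\beta^{|\ell_1-\ell_2|}.$$ -/

import Mathlib

open MeasureTheory ProbabilityTheory

/-- The spatial autoregressive process on the quarter plane driven by the noise `ε`, with zero
boundary values:
`X (k, ℓ) = α X (k-1, ℓ) + β X (k, ℓ-1) + γ X (k-1, ℓ-1) + ε (k, ℓ)` for `k, ℓ ≥ 1`, and
`X (k, 0) = X (0, ℓ) = 0` for `k, ℓ ≥ 0`. The noise is indexed by pairs of positive integers. -/
def spatialAR {Ω : Type*} (α β γ : ℝ) (ε : ℕ+ → ℕ+ → Ω → ℝ) : ℕ → ℕ → Ω → ℝ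
  | 0, _, _ => 0
  | _ + 1, 0, _ => 0
  | k + 1, l + 1, ω =>
      α * spatialAR α β γ ε k (l + 1) ω + β * spatialAR α β γ ε (k + 1) l ω
        + γ * spatialAR α β γ ε k l ω + ε k.succPNat l.succPNat ω
  termination_by k l => k + l

/-- The distance `|k₁ - k₂|` of two natural numbers, as a natural number. -/
def absDiff (k₁ k₂ : ℕ) : ℕ := ((k₁ : ℤ) - (k₂ : ℤ)).natAbs

/-- `ε` is a family of independent square-integrable random variables with mean zero and
variance one. -/
structure IsUnitNoise {Ω : Type*} [MeasurableSpace Ω] (P : Measure Ω)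
    (ε : ℕ+ → ℕ+ → Ω → ℝ) : Prop where
  memLp : ∀ k l, MemLp (ε k l) 2 P
  indep : iIndepFun (fun p : ℕ+ × ℕ+ => ε p.1 p.2) P
  mean : ∀ k l, ∫ ω, ε k l ω ∂P = 0
  variance : ∀ k l, variance (ε k l) P = 1

/-! Let G = `green`. Then X is a sum of G-weighted noise variables, and their orthonormality turns
the covariance into a sum of products of two shifted copies of G over the common rectangle
(`covariance_spatialAR`). Everything else is an estimate of G.

If |α|+|β|+|γ| < 1, then G decays geometrically (`abs_green_le_pow`). If γ = -αβ, which the sign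
condition forces when |α| or |β| is 1, then G is a product of powers (`green_eq_pow_mul_pow`).

The critical case reduces by signs to α, β ≥ 0 and γ = 1-α-β, where G ≥ 0. Read n as time: an energy
of the row G(·, n) loses a multiple of its Dirichlet sum at each step, while its mass stays bounded.
A Nash inequality then gives F(n+1) ≤ F(n) - κF(n)³, hence F(n) = O(n^(-1/2)), and summing over n
yields the square root (`sum_green_sq_le`). -/

/-- The response at `(m, n)` of the autoregression with coefficients `α`, `β`, `γ` to a unit
impulse at `(1, 1)`. -/
def green (α β γ : ℝ) : ℕ → ℕ → ℝ
  | 0, _ => 0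
  | _ + 1, 0 => 0
  | m + 1, n + 1 =>
      α * green α β γ m (n + 1) + β * green α β γ (m + 1) n + γ * green α β γ m n
        + if m = 0 ∧ n = 0 then 1 else 0
  termination_by m n => m + n

/-! ### Impulse response. -/

section Green

variable (α β γ : ℝ)

@[simp] lemma green_zero_left (n : ℕ) : green α β γ 0 n = 0 := by rw [green]

@[simp] lemma green_zero_right (m : ℕ) : green α β γ m 0 = 0 := by
  cases m <;> rw [green]

lemma green_succ_succ (m n : ℕ) :
    green α β γ (m + 1) (n + 1) =
      α * green α β γ m (n + 1) + β * green α β γ (m + 1) n + γ * green α β γ m n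
        + if m = 0 ∧ n = 0 then 1 else 0 := by rw [green]

/-- Truncated subtraction sends sites beyond (k, l) to the zero boundary, so every X can be written
as a sum over one common rectangle. -/
lemma green_succ_sub_succ_sub (k l i j : ℕ) :
    green α β γ (k + 1 - i) (l + 1 - j) =
      α * green α β γ (k - i) (l + 1 - j) + β * green α β γ (k + 1 - i) (l - j)
        + γ * green α β γ (k - i) (l - j) + if k = i ∧ l = j then 1 else 0 := by
  rcases lt_or_ge k i with hi | hi
  · rw [Nat.sub_eq_zero_of_le (Nat.succ_le_of_lt hi), Nat.sub_eq_zero_of_le hi.le]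
    simp [hi.ne]
  rcases lt_or_ge l j with hj | hj
  · rw [Nat.sub_eq_zero_of_le (Nat.succ_le_of_lt hj), Nat.sub_eq_zero_of_le hj.le]
    simp [hj.ne]
  · rw [Nat.sub_add_comm hi, Nat.sub_add_comm hj, green_succ_succ]
    congr 1
    refine if_congr ?_ rfl rfl
    omega

end Green

/-! ### Moving-average representation and covariance formula. -/

section Covariance

variable {Ω : Type*} (α β γ : ℝ)

lemma spatialAR_zero_left (ε : ℕ+ → ℕ+ → Ω → ℝ) (l : ℕ) (ω : Ω) :
    spatialAR α β γ ε 0 l ω = 0 := by rw [spatialAR]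

lemma spatialAR_zero_right (ε : ℕ+ → ℕ+ → Ω → ℝ) (k : ℕ) (ω : Ω) :
    spatialAR α β γ ε k 0 ω = 0 := by cases k <;> rw [spatialAR]

lemma spatialAR_eq_sum (ε : ℕ+ → ℕ+ → Ω → ℝ) (ω : Ω) {K L : ℕ} :
    ∀ {k l : ℕ}, k ≤ K → l ≤ L → spatialAR α β γ ε k l ω =
      ∑ p ∈ Finset.range K ×ˢ Finset.range L,
        green α β γ (k - p.1) (l - p.2) * ε p.1.succPNat p.2.succPNat ω := by
  intro k
  induction k with
  | zero => intro l _ _; simp [spatialAR_zero_left]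
  | succ k ihk =>
    intro l hk hl
    induction l with
    | zero => simp [spatialAR_zero_right]
    | succ l ihl =>
      rw [spatialAR, ihk (by omega) hl, ihk (by omega) (by omega), ihl (by omega)]
      have hsource : ε k.succPNat l.succPNat ω =
          ∑ p ∈ Finset.range K ×ˢ Finset.range L,
            (if k = p.1 ∧ l = p.2 then 1 else 0) * ε p.1.succPNat p.2.succPNat ω := by
        rw [Finset.sum_eq_single (k, l)]
        · simp
        · rintro ⟨i, j⟩ _ hne
          rw [if_neg, zero_mul]
          rintro ⟨rfl, rfl⟩
          exact hne rfl
        · intro h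
          refine absurd (Finset.mem_product.2 ⟨?_, ?_⟩) h
          · exact Finset.mem_range.2 (by omega)
          · exact Finset.mem_range.2 (by omega)
      rw [hsource, Finset.mul_sum, Finset.mul_sum, Finset.mul_sum, ← Finset.sum_add_distrib,
        ← Finset.sum_add_distrib, ← Finset.sum_add_distrib]
      refine Finset.sum_congr rfl fun p _ => ?_
      rw [green_succ_sub_succ_sub]
      ring

lemma sum_range_eq_sum_reflect {K p : ℕ} (hp : p ≤ K) (f : ℕ → ℝ) (hf : ∀ i, p ≤ i → f i = 0) :
    ∑ i ∈ Finset.range K, f i = ∑ i ∈ Finset.range p, f (p - 1 - i) := by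
  rw [Finset.sum_range_reflect]
  refine (Finset.sum_subset (Finset.range_mono hp) fun i _ hi => hf i ?_).symm
  simpa using hi

lemma covariance_spatialAR [MeasurableSpace Ω] (P : Measure Ω) [IsProbabilityMeasure P]
    {ε : ℕ+ → ℕ+ → Ω → ℝ} (hε : IsUnitNoise P ε) (k₁ l₁ k₂ l₂ : ℕ) :
    covariance (spatialAR α β γ ε k₁ l₁) (spatialAR α β γ ε k₂ l₂) P =
      ∑ m ∈ Finset.range (min k₁ k₂), ∑ n ∈ Finset.range (min l₁ l₂),
        green α β γ (k₁ - min k₁ k₂ + m + 1) (l₁ - min l₁ l₂ + n + 1) *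
          green α β γ (k₂ - min k₁ k₂ + m + 1) (l₂ - min l₁ l₂ + n + 1) := by
  have hrep : ∀ k l, k ≤ max k₁ k₂ → l ≤ max l₁ l₂ → spatialAR α β γ ε k l = fun ω =>
      ∑ p ∈ Finset.range (max k₁ k₂) ×ˢ Finset.range (max l₁ l₂),
        green α β γ (k - p.1) (l - p.2) * ε p.1.succPNat p.2.succPNat ω :=
    fun k l hk hl => funext fun ω => spatialAR_eq_sum α β γ ε ω hk hl
  have hmem : ∀ (c : ℝ) (p : ℕ × ℕ),
      MemLp (fun ω => c * ε p.1.succPNat p.2.succPNat ω) 2 P :=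
    fun c p => (hε.memLp _ _).const_mul c
  have hcov : ∀ p q : ℕ × ℕ, covariance (ε p.1.succPNat p.2.succPNat)
      (ε q.1.succPNat q.2.succPNat) P = if p = q then 1 else 0 := by
    intro p q
    split_ifs with h
    · rw [h, covariance_self (hε.memLp _ _).aemeasurable, hε.variance]
    · refine (hε.indep.indepFun (i := (p.1.succPNat, p.2.succPNat))
        (j := (q.1.succPNat, q.2.succPNat)) ?_).covariance_eq_zero (hε.memLp _ _) (hε.memLp _ _)
      intro heq
      rw [Prod.mk.injEq, Nat.succPNat_inj, Nat.succPNat_inj] at heq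
      exact h (Prod.ext heq.1 heq.2)
  rw [hrep k₁ l₁ (le_max_left _ _) (le_max_left _ _),
    hrep k₂ l₂ (le_max_right _ _) (le_max_right _ _),
    covariance_fun_sum_fun_sum' (fun p _ => hmem _ p) (fun p _ => hmem _ p)]
  simp_rw [covariance_const_mul_left, covariance_const_mul_right, hcov]
  have hdiag : ∀ p ∈ Finset.range (max k₁ k₂) ×ˢ Finset.range (max l₁ l₂),
      ∑ q ∈ Finset.range (max k₁ k₂) ×ˢ Finset.range (max l₁ l₂),
        green α β γ (k₁ - p.1) (l₁ - p.2) *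
          (green α β γ (k₂ - q.1) (l₂ - q.2) * if p = q then 1 else 0) =
      green α β γ (k₁ - p.1) (l₁ - p.2) * green α β γ (k₂ - p.1) (l₂ - p.2) := by
    intro p hp
    simp only [mul_ite, mul_one, mul_zero, Finset.sum_ite_eq, if_pos hp]
  -- Only noise inside both rectangles contributes. Reflecting the indices measures each site from
  -- the far corner of the overlap.
  rw [Finset.sum_congr rfl hdiag, Finset.sum_product,
    sum_range_eq_sum_reflect (p := min k₁ k₂) (by omega)]
  · refine Finset.sum_congr rfl fun m hm => ?_
    rw [Finset.mem_range] at hm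
    rw [sum_range_eq_sum_reflect (p := min l₁ l₂) (by omega)]
    · refine Finset.sum_congr rfl fun n hn => ?_
      rw [Finset.mem_range] at hn
      congr 2 <;> omega
    · intro j hj
      rcases le_total l₁ l₂ with h | h
      · rw [Nat.sub_eq_zero_of_le (show l₁ ≤ j by omega)]; simp
      · rw [Nat.sub_eq_zero_of_le (show l₂ ≤ j by omega)]; simp
  · intro i hi
    refine Finset.sum_eq_zero fun j _ => ?_
    rcases le_total k₁ k₂ with h | h
    · rw [Nat.sub_eq_zero_of_le (show k₁ ≤ i by omega)]; simp
    · rw [Nat.sub_eq_zero_of_le (show k₂ ≤ i by omega)]; simp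

end Covariance

lemma absDiff_eq_sub_min_add_sub_min (k₁ k₂ : ℕ) :
    absDiff k₁ k₂ = (k₁ - min k₁ k₂) + (k₂ - min k₁ k₂) := by
  unfold absDiff
  omega

/-! ### Geometric decay and factorization of the impulse response. -/

section Bounds

variable {α β γ : ℝ}

/-- One recursion step lowers m + n by at most 2 and carries total weight r². This is why the rate
is the square root of |α|+|β|+|γ|. -/
lemma abs_green_le_pow {r : ℝ} (hr : 0 ≤ r) (hr1 : r ≤ 1) (h : |α| + |β| + |γ| = r ^ 2)
    (m n : ℕ) : |green α β γ (m + 1) (n + 1)| ≤ r ^ (m + n) := by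
  have hα := abs_nonneg α
  have hβ := abs_nonneg β
  have hγ := abs_nonneg γ
  have hsq : r ^ 2 ≤ r := by nlinarith
  induction m generalizing n with
  | zero =>
    induction n with
    | zero => simp [green_succ_succ]
    | succ n ih =>
      rw [green_succ_succ]
      simp only [green_zero_left, mul_zero, zero_add, add_zero, abs_mul, Nat.succ_ne_zero,
        and_false, if_false]
      calc |β| * |green α β γ 1 (n + 1)| ≤ r * r ^ n := by
            refine mul_le_mul (by linarith) (by simpa using ih) (abs_nonneg _) hr
        _ = r ^ (n + 1) := by ring
  | succ m ihm =>
    induction n with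
    | zero =>
      rw [green_succ_succ]
      simp only [green_zero_right, mul_zero, zero_add, add_zero, abs_mul, Nat.succ_ne_zero,
        false_and, if_false]
      calc |α| * |green α β γ (m + 1) 1| ≤ r * r ^ m := by
            refine mul_le_mul (by linarith) (by simpa using ihm 0) (abs_nonneg _) hr
        _ = r ^ (m + 1) := by ring
    | succ n ihn =>
      rw [green_succ_succ]
      simp only [Nat.succ_ne_zero, false_and, if_false, add_zero]
      have hp : 0 ≤ r ^ (m + n) := by positivity
      have hle : r ^ (m + n + 1) ≤ r ^ (m + n) := pow_le_pow_of_le_one hr hr1 (by omega)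
      have h1 := mul_le_mul_of_nonneg_left ((ihm (n + 1)).trans hle) hα
      have h2 := mul_le_mul_of_nonneg_left
        (ihn.trans ((show r ^ (m + 1 + n) = r ^ (m + n + 1) by ring).le.trans hle)) hβ
      have h3 := mul_le_mul_of_nonneg_left (ihm n) hγ
      rw [← abs_mul] at h1 h2 h3
      calc _ ≤ _ := (abs_add_le _ _).trans (add_le_add_left (abs_add_le _ _) _)
        _ ≤ |α| * r ^ (m + n) + |β| * r ^ (m + n) + |γ| * r ^ (m + n) := by
            exact add_le_add (add_le_add h1 h2) h3
        _ = r ^ 2 * r ^ (m + n) := by rw [← h]; ring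
        _ = r ^ (m + 1 + (n + 1)) := by ring

/-- The characteristic polynomial 1 - αx - βy - γxy splits as (1 - αx)(1 - βy). -/
lemma green_eq_pow_mul_pow (h : γ = -(α * β)) (m n : ℕ) :
    green α β γ (m + 1) (n + 1) = α ^ m * β ^ n := by
  induction m generalizing n with
  | zero =>
    induction n with
    | zero => simp [green_succ_succ]
    | succ n ih =>
      rw [green_succ_succ]
      simp only [zero_add] at ih ⊢
      rw [ih]
      simp
      ring
  | succ m ihm =>
    induction n with
    | zero =>
      rw [green_succ_succ]
      have := ihm 0
      simp only [zero_add] at this ⊢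
      rw [this]
      simp
      ring
    | succ n ihn =>
      rw [green_succ_succ, ihm, ihm, ihn, h]
      simp
      ring

lemma sum_range_pow_le {x : ℝ} (hx : 0 ≤ x) (hx1 : x < 1) (N : ℕ) :
    ∑ n ∈ Finset.range N, x ^ n ≤ 1 / (1 - x) := by
  rw [le_div_iff₀ (by linarith), geom_sum_mul_neg]
  linarith [pow_nonneg hx N]

end Bounds

/-! ### Covariances in the subcritical and factorized cases. -/

section CovarianceBounds

variable {Ω : Type*} [MeasurableSpace Ω] (P : Measure Ω) [IsProbabilityMeasure P]
  {ε : ℕ+ → ℕ+ → Ω → ℝ} {α β γ : ℝ}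

lemma abs_covariance_le_of_sum_lt_one (hε : IsUnitNoise P ε) (h : |α| + |β| + |γ| < 1)
    (k₁ l₁ k₂ l₂ : ℕ) :
    |covariance (spatialAR α β γ ε k₁ l₁) (spatialAR α β γ ε k₂ l₂) P| ≤
      (|α| + |β| + |γ|) ^ (((absDiff k₁ k₂ : ℝ) + (absDiff l₁ l₂ : ℝ)) / 2) /
        (1 - (|α| + |β| + |γ|)) ^ 2 := by
  set s := |α| + |β| + |γ| with hs
  have hs0 : 0 ≤ s := by positivity
  set r := √s with hr
  have hr0 : 0 ≤ r := Real.sqrt_nonneg _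
  have hr1 : r ≤ 1 := Real.sqrt_le_one.2 h.le
  have hrs : s = r ^ 2 := (Real.sq_sqrt hs0).symm
  have hg := abs_green_le_pow (α := α) (β := β) (γ := γ) hr0 hr1 (hs ▸ hrs)
  have hpow : s ^ (((absDiff k₁ k₂ : ℝ) + (absDiff l₁ l₂ : ℝ)) / 2) =
      r ^ (absDiff k₁ k₂ + absDiff l₁ l₂) := by
    rw [hr, Real.sqrt_eq_rpow, ← Real.rpow_natCast, ← Real.rpow_mul hs0]
    push_cast
    congr 1
    ring
  rw [covariance_spatialAR α β γ P hε, hpow, absDiff_eq_sub_min_add_sub_min k₁ k₂,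
    absDiff_eq_sub_min_add_sub_min l₁ l₂]
  generalize k₁ - min k₁ k₂ = a₁
  generalize k₂ - min k₁ k₂ = a₂
  generalize l₁ - min l₁ l₂ = b₁
  generalize l₂ - min l₁ l₂ = b₂
  generalize min k₁ k₂ = p
  generalize min l₁ l₂ = q
  calc _ ≤ ∑ m ∈ Finset.range p, ∑ n ∈ Finset.range q,
        r ^ (a₁ + a₂ + (b₁ + b₂)) * (s ^ m * s ^ n) := by
        refine (Finset.abs_sum_le_sum_abs _ _).trans (Finset.sum_le_sum fun m _ => ?_)
        refine (Finset.abs_sum_le_sum_abs _ _).trans (Finset.sum_le_sum fun n _ => ?_)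
        rw [abs_mul]
        refine (mul_le_mul (hg _ _) (hg _ _) (abs_nonneg _) (by positivity)).trans (le_of_eq ?_)
        rw [hrs]
        ring
    _ = r ^ (a₁ + a₂ + (b₁ + b₂)) *
          ((∑ m ∈ Finset.range p, s ^ m) * ∑ n ∈ Finset.range q, s ^ n) := by
        rw [Finset.sum_mul_sum]
        simp_rw [Finset.mul_sum]
    _ ≤ r ^ (a₁ + a₂ + (b₁ + b₂)) * (1 / (1 - s) * (1 / (1 - s))) := by
        refine mul_le_mul_of_nonneg_left ?_ (by positivity)
        have h1 := sum_range_pow_le hs0 h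
        exact mul_le_mul (h1 p) (h1 q) (by positivity) (le_trans (by positivity) (h1 p))
    _ = _ := by
        rw [pow_two]
        field_simp

lemma abs_covariance_le_of_factorized_left (hε : IsUnitNoise P ε) (h : γ = -(α * β))
    (hα : |α| = 1) (hβ : |β| < 1) (k₁ l₁ k₂ l₂ : ℕ) :
    |covariance (spatialAR α β γ ε k₁ l₁) (spatialAR α β γ ε k₂ l₂) P| ≤
      (min k₁ k₂ : ℕ) * (|β| ^ absDiff l₁ l₂ / (1 - β ^ 2)) := by
  rw [covariance_spatialAR α β γ P hε, absDiff_eq_sub_min_add_sub_min l₁ l₂]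
  simp_rw [green_eq_pow_mul_pow h]
  generalize k₁ - min k₁ k₂ = a₁
  generalize k₂ - min k₁ k₂ = a₂
  generalize l₁ - min l₁ l₂ = b₁
  generalize l₂ - min l₁ l₂ = b₂
  generalize min k₁ k₂ = p
  generalize min l₁ l₂ = q
  have hβ2 : β ^ 2 < 1 := (sq_lt_one_iff_abs_lt_one β).2 hβ
  refine (Finset.abs_sum_le_sum_abs _ _).trans
    ((Finset.sum_le_card_nsmul _ _ (|β| ^ (b₁ + b₂) / (1 - β ^ 2)) fun m _ => ?_).trans_eq ?_)
  · calc _ ≤ ∑ n ∈ Finset.range q, |β| ^ (b₁ + b₂) * (β ^ 2) ^ n := by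
          refine (Finset.abs_sum_le_sum_abs _ _).trans (Finset.sum_le_sum fun n _ => le_of_eq ?_)
          simp only [abs_mul, abs_pow, hα, one_pow, one_mul]
          rw [← sq_abs β]
          ring
      _ = |β| ^ (b₁ + b₂) * ∑ n ∈ Finset.range q, (β ^ 2) ^ n := by rw [Finset.mul_sum]
      _ ≤ |β| ^ (b₁ + b₂) * (1 / (1 - β ^ 2)) :=
          mul_le_mul_of_nonneg_left (sum_range_pow_le (sq_nonneg β) hβ2 q) (by positivity)
      _ = _ := by rw [mul_one_div]
  · rw [Finset.card_range, nsmul_eq_mul]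

lemma abs_covariance_le_of_factorized_right (hε : IsUnitNoise P ε) (h : γ = -(α * β))
    (hβ : |β| = 1) (hα : |α| < 1) (k₁ l₁ k₂ l₂ : ℕ) :
    |covariance (spatialAR α β γ ε k₁ l₁) (spatialAR α β γ ε k₂ l₂) P| ≤
      (min l₁ l₂ : ℕ) * (|α| ^ absDiff k₁ k₂ / (1 - α ^ 2)) := by
  rw [covariance_spatialAR α β γ P hε, absDiff_eq_sub_min_add_sub_min k₁ k₂, Finset.sum_comm]
  simp_rw [green_eq_pow_mul_pow h]
  generalize k₁ - min k₁ k₂ = a₁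
  generalize k₂ - min k₁ k₂ = a₂
  generalize l₁ - min l₁ l₂ = b₁
  generalize l₂ - min l₁ l₂ = b₂
  generalize min k₁ k₂ = p
  generalize min l₁ l₂ = q
  have hα2 : α ^ 2 < 1 := (sq_lt_one_iff_abs_lt_one α).2 hα
  refine (Finset.abs_sum_le_sum_abs _ _).trans
    ((Finset.sum_le_card_nsmul _ _ (|α| ^ (a₁ + a₂) / (1 - α ^ 2)) fun n _ => ?_).trans_eq ?_)
  · calc _ ≤ ∑ m ∈ Finset.range p, |α| ^ (a₁ + a₂) * (α ^ 2) ^ m := by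
          refine (Finset.abs_sum_le_sum_abs _ _).trans (Finset.sum_le_sum fun m _ => le_of_eq ?_)
          simp only [abs_mul, abs_pow, hβ, one_pow, mul_one]
          rw [← sq_abs α]
          ring
      _ = |α| ^ (a₁ + a₂) * ∑ m ∈ Finset.range p, (α ^ 2) ^ m := by rw [Finset.mul_sum]
      _ ≤ |α| ^ (a₁ + a₂) * (1 / (1 - α ^ 2)) :=
          mul_le_mul_of_nonneg_left (sum_range_pow_le (sq_nonneg α) hα2 p) (by positivity)
      _ = _ := by rw [mul_one_div]
  · rw [Finset.card_range, nsmul_eq_mul]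

lemma covariance_eq_of_factorized_unit (hε : IsUnitNoise P ε) (h : γ = -(α * β))
    (hα : |α| = 1) (hβ : |β| = 1) (k₁ l₁ k₂ l₂ : ℕ) :
    covariance (spatialAR α β γ ε k₁ l₁) (spatialAR α β γ ε k₂ l₂) P =
      (min k₁ k₂ : ℕ) * (min l₁ l₂ : ℕ) * α ^ absDiff k₁ k₂ * β ^ absDiff l₁ l₂ := by
  rw [covariance_spatialAR α β γ P hε, absDiff_eq_sub_min_add_sub_min k₁ k₂,
    absDiff_eq_sub_min_add_sub_min l₁ l₂]
  simp_rw [green_eq_pow_mul_pow h]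
  generalize k₁ - min k₁ k₂ = a₁
  generalize k₂ - min k₁ k₂ = a₂
  generalize l₁ - min l₁ l₂ = b₁
  generalize l₂ - min l₁ l₂ = b₂
  generalize min k₁ k₂ = p
  generalize min l₁ l₂ = q
  have hterm : ∀ m n : ℕ, α ^ (a₁ + m) * β ^ (b₁ + n) * (α ^ (a₂ + m) * β ^ (b₂ + n)) =
      α ^ (a₁ + a₂) * β ^ (b₁ + b₂) := by
    intro m n
    have hα2 : α ^ 2 = 1 := by rw [← sq_abs, hα, one_pow]
    have hβ2 : β ^ 2 = 1 := by rw [← sq_abs, hβ, one_pow]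
    calc _ = α ^ (a₁ + a₂) * β ^ (b₁ + b₂) * ((α ^ 2) ^ m * (β ^ 2) ^ n) := by ring
      _ = _ := by rw [hα2, hβ2, one_pow, one_pow, mul_one, mul_one]
  simp_rw [hterm]
  simp only [Finset.sum_const, Finset.card_range, nsmul_eq_mul]
  ring

end CovarianceBounds

/-! ### Energy decay in the critical case with nonnegative α, β. -/

section CriticalGreen

variable {α β : ℝ}

/-- Here γ = 1-α-β may be negative. The increment G(m, n+1) - βG(m, n) obeys a recursion in m with
coefficient α and source (αβ+γ)G(m, n) plus the impulse, and αβ+γ = (1-α)(1-β) ≥ 0. -/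
lemma green_nonneg (hα : 0 ≤ α) (hα1 : α ≤ 1) (hβ : 0 ≤ β) (hβ1 : β ≤ 1) (m n : ℕ) :
    0 ≤ green α β (1 - α - β) m n := by
  induction n generalizing m with
  | zero => simp
  | succ n ih =>
    have hincr : ∀ m, 0 ≤ green α β (1 - α - β) m (n + 1) - β * green α β (1 - α - β) m n := by
      intro m
      induction m with
      | zero => simp
      | succ m ihm =>
        have hind : (0 : ℝ) ≤ if m = 0 ∧ n = 0 then 1 else 0 := by split_ifs <;> norm_num
        have h1 := mul_nonneg hα ihm
        have h2 := mul_nonneg (mul_nonneg (sub_nonneg.2 hα1) (sub_nonneg.2 hβ1)) (ih m)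
        rw [green_succ_succ]
        nlinarith
    linarith [hincr m, mul_nonneg hβ (ih m)]

/-- Energy identity: since β+γ = 1-α, the two quadratic forms agree on constants, so they differ by
a Dirichlet sum and a boundary term. The coefficient is α+βγ = (1-β)(α+β). -/
lemma sum_range_sq_next_row (α β : ℝ) (v : ℕ → ℝ) (hv : v 0 = 0) (K : ℕ) :
    ∑ m ∈ Finset.range K, (β * v (m + 1) + (1 - α - β) * v m) ^ 2 =
      ∑ m ∈ Finset.range K, (v (m + 1) - α * v m) ^ 2
        - (1 - β) * (α + β) * ∑ m ∈ Finset.range K, (v (m + 1) - v m) ^ 2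
        - (1 - β) * (1 - α) * v K ^ 2 := by
  induction K with
  | zero => simp [hv]
  | succ K ih =>
    rw [Finset.sum_range_succ, Finset.sum_range_succ, Finset.sum_range_succ, ih]
    ring

lemma sum_range_next_row (α β : ℝ) (v : ℕ → ℝ) (hv : v 0 = 0) (K : ℕ) :
    ∑ m ∈ Finset.range K, (β * v (m + 1) + (1 - α - β) * v m) =
      ∑ m ∈ Finset.range K, (v (m + 1) - α * v m) - (1 - β) * v K := by
  induction K with
  | zero => simp [hv]
  | succ K ih =>
    rw [Finset.sum_range_succ, Finset.sum_range_succ, ih]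
    ring

lemma sum_range_sub_mul (α : ℝ) (v : ℕ → ℝ) (hv : v 0 = 0) (K : ℕ) :
    ∑ m ∈ Finset.range K, (v (m + 1) - α * v m) =
      (1 - α) * ∑ m ∈ Finset.range K, v (m + 1) + α * v K := by
  induction K with
  | zero => simp [hv]
  | succ K ih =>
    rw [Finset.sum_range_succ, Finset.sum_range_succ, ih]
    ring

lemma sum_range_sq_eq_add (v : ℕ → ℝ) (hv : v 0 = 0) (K : ℕ) :
    ∑ m ∈ Finset.range K, v (m + 1) ^ 2 = ∑ m ∈ Finset.range K, v m ^ 2 + v K ^ 2 := by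
  have h := Finset.sum_range_succ' (fun m => v m ^ 2) K
  rw [Finset.sum_range_succ] at h
  simpa [hv] using h.symm

lemma sum_range_sq_sub_mul_le (hα : 0 ≤ α) (hα1 : α ≤ 1) (v : ℕ → ℝ) (hv : v 0 = 0) (K : ℕ) :
    ∑ m ∈ Finset.range K, (v (m + 1) - α * v m) ^ 2 ≤
      4 * ∑ m ∈ Finset.range K, v (m + 1) ^ 2 := by
  have hE := sum_range_sq_eq_add v hv K
  calc _ ≤ ∑ m ∈ Finset.range K, (2 * v (m + 1) ^ 2 + 2 * v m ^ 2) := by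
        refine Finset.sum_le_sum fun m _ => ?_
        have hα2 : α ^ 2 ≤ 1 := pow_le_one₀ hα hα1
        nlinarith [sq_nonneg (v (m + 1) + α * v m), sq_nonneg (v m)]
    _ = 2 * ∑ m ∈ Finset.range K, v (m + 1) ^ 2 + 2 * ∑ m ∈ Finset.range K, v m ^ 2 := by
        rw [Finset.sum_add_distrib, Finset.mul_sum, Finset.mul_sum]
    _ ≤ _ := by linarith [sq_nonneg (v K)]

/-- Termwise, (x - αy)² = (1-α)x² - α(1-α)y² + α(x-y)². -/
lemma mul_sum_range_sq_le (hα : 0 ≤ α) (hα1 : α ≤ 1) (v : ℕ → ℝ) (hv : v 0 = 0) (K : ℕ) :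
    (1 - α) ^ 2 * ∑ m ∈ Finset.range K, v (m + 1) ^ 2 ≤
      ∑ m ∈ Finset.range K, (v (m + 1) - α * v m) ^ 2 := by
  have hE := sum_range_sq_eq_add v hv K
  calc (1 - α) ^ 2 * ∑ m ∈ Finset.range K, v (m + 1) ^ 2
      ≤ (1 - α) * ∑ m ∈ Finset.range K, v (m + 1) ^ 2
        - α * (1 - α) * ∑ m ∈ Finset.range K, v m ^ 2 := by
        have := mul_nonneg (mul_nonneg hα (sub_nonneg.2 hα1)) (sq_nonneg (v K))
        rw [hE]
        linarith
    _ = ∑ m ∈ Finset.range K, ((1 - α) * v (m + 1) ^ 2 - α * (1 - α) * v m ^ 2) := by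
        rw [Finset.sum_sub_distrib, Finset.mul_sum, Finset.mul_sum]
    _ ≤ _ := by
        refine Finset.sum_le_sum fun m _ => ?_
        nlinarith [mul_nonneg hα (sq_nonneg (v (m + 1) - v m))]

/-- A discrete Nash inequality on a half-line. -/
lemma sum_range_sq_pow_three_le (v : ℕ → ℝ) (hv : v 0 = 0) (hpos : ∀ m, 0 ≤ v m) (K : ℕ) :
    (∑ m ∈ Finset.range K, v (m + 1) ^ 2) ^ 3 ≤
      4 * (∑ m ∈ Finset.range K, v (m + 1)) ^ 4 *
        ∑ m ∈ Finset.range K, (v (m + 1) - v m) ^ 2 := by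
  set E := ∑ m ∈ Finset.range K, v (m + 1) ^ 2 with hE
  set M := ∑ m ∈ Finset.range K, v (m + 1) with hM
  set D := ∑ m ∈ Finset.range K, (v (m + 1) - v m) ^ 2 with hD
  have hE0 : 0 ≤ E := Finset.sum_nonneg fun _ _ => sq_nonneg _
  have hD0 : 0 ≤ D := Finset.sum_nonneg fun _ _ => sq_nonneg _
  have hM0 : 0 ≤ M := Finset.sum_nonneg fun _ _ => hpos _
  have hsum : ∑ m ∈ Finset.range K, (|v (m + 1)| + |v m|) ^ 2 ≤ 4 * E := by
    have hshift := sum_range_sq_eq_add v hv K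
    calc _ ≤ ∑ m ∈ Finset.range K, (2 * v (m + 1) ^ 2 + 2 * v m ^ 2) := by
          refine Finset.sum_le_sum fun m _ => ?_
          rw [abs_of_nonneg (hpos _), abs_of_nonneg (hpos _)]
          nlinarith [sq_nonneg (v (m + 1) - v m)]
      _ = 2 * E + 2 * ∑ m ∈ Finset.range K, v m ^ 2 := by
          rw [Finset.sum_add_distrib, Finset.mul_sum, Finset.mul_sum]
      _ ≤ _ := by linarith [sq_nonneg (v K)]
  -- Telescoping v² from v 0 = 0 and Cauchy–Schwarz give (sup v)⁴ ≤ 4DE. Combined with E ≤ (sup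
  -- v)·M, this gives the claim after cancelling one factor E.
  have hsup : ∀ m ∈ Finset.range K, v (m + 1) ≤ √(√(4 * D * E)) := by
    intro m hm
    refine Real.le_sqrt_of_sq_le (Real.le_sqrt_of_sq_le ?_)
    have htel : v (m + 1) ^ 2 ≤
        ∑ j ∈ Finset.range K, |v (j + 1) - v j| * (|v (j + 1)| + |v j|) := by
      calc v (m + 1) ^ 2 = ∑ j ∈ Finset.range (m + 1), (v (j + 1) ^ 2 - v j ^ 2) := by
            rw [Finset.sum_range_sub (fun j => v j ^ 2), hv]
            ring
        _ ≤ ∑ j ∈ Finset.range (m + 1), |v (j + 1) - v j| * (|v (j + 1)| + |v j|) := by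
            refine Finset.sum_le_sum fun j _ => ?_
            rw [abs_of_nonneg (hpos _), abs_of_nonneg (hpos j)]
            nlinarith [mul_le_mul_of_nonneg_right (le_abs_self (v (j + 1) - v j))
              (add_nonneg (hpos (j + 1)) (hpos j))]
        _ ≤ _ := by
            refine Finset.sum_le_sum_of_subset_of_nonneg (Finset.range_mono ?_)
              fun j _ _ => by positivity
            exact Finset.mem_range.1 hm
    calc (v (m + 1) ^ 2) ^ 2
        ≤ (∑ j ∈ Finset.range K, |v (j + 1) - v j| * (|v (j + 1)| + |v j|)) ^ 2 :=
          pow_le_pow_left₀ (sq_nonneg _) htel 2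
      _ ≤ (∑ j ∈ Finset.range K, |v (j + 1) - v j| ^ 2) *
            ∑ j ∈ Finset.range K, (|v (j + 1)| + |v j|) ^ 2 :=
          Finset.sum_mul_sq_le_sq_mul_sq _ _ _
      _ ≤ D * (4 * E) := by
          simp_rw [sq_abs]
          exact mul_le_mul_of_nonneg_left hsum hD0
      _ = 4 * D * E := by ring
  have hEM : E ≤ √(√(4 * D * E)) * M := by
    rw [hE, hM, Finset.mul_sum]
    refine Finset.sum_le_sum fun m hm => ?_
    rw [pow_two]
    exact mul_le_mul_of_nonneg_right (hsup m hm) (hpos _)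
  have h4 : E ^ 4 ≤ 4 * D * E * M ^ 4 := by
    calc E ^ 4 ≤ (√(√(4 * D * E)) * M) ^ 4 := pow_le_pow_left₀ hE0 hEM 4
      _ = ((√(√(4 * D * E))) ^ 2) ^ 2 * M ^ 4 := by ring
      _ = 4 * D * E * M ^ 4 := by
          rw [Real.sq_sqrt (Real.sqrt_nonneg _), Real.sq_sqrt (by positivity)]
  rcases hE0.eq_or_lt with h0 | h0
  · rw [← h0, zero_pow three_ne_zero]
    positivity
  · refine le_of_mul_le_mul_right ?_ h0
    linarith

/-- A nonnegative sequence with `F (n + 1) ≤ F n - κ * F n ^ 3` decays like `1 / √n`. -/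
lemma sq_mul_le_one_of_le_sub_cube {F : ℕ → ℝ} {κ : ℝ} (hκ : 0 ≤ κ) (hF : ∀ n, 0 ≤ F n)
    (h0 : F 0 ≤ 1) (hstep : ∀ n, F (n + 1) ≤ F n - κ * F n ^ 3) (n : ℕ) :
    F n ^ 2 * (1 + κ * n) ≤ 1 := by
  induction n with
  | zero =>
    rw [Nat.cast_zero, mul_zero, add_zero, mul_one]
    exact pow_le_one₀ (hF 0) h0
  | succ n ih =>
    set t := κ * F n ^ 2 with ht
    have ht0 : 0 ≤ t := by positivity
    have hle : F (n + 1) ≤ F n * (1 - t) := by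
      have := hstep n
      rw [ht]
      linarith
    rcases (hF n).eq_or_lt with h | h
    · have : F (n + 1) = 0 := le_antisymm (by rw [← h] at hle; linarith) (hF _)
      rw [this]
      norm_num
    have ht1 : 0 ≤ 1 - t := nonneg_of_mul_nonneg_right ((hF _).trans hle) h
    have hsq : F (n + 1) ^ 2 ≤ (F n * (1 - t)) ^ 2 := pow_le_pow_left₀ (hF _) hle 2
    have hpos : (0 : ℝ) ≤ 1 + κ * (n + 1 : ℕ) := by positivity
    calc F (n + 1) ^ 2 * (1 + κ * (n + 1 : ℕ))
        ≤ (F n * (1 - t)) ^ 2 * (1 + κ * (n + 1 : ℕ)) := mul_le_mul_of_nonneg_right hsq hpos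
      _ = (1 - t) ^ 2 * (F n ^ 2 * (1 + κ * n) + t) := by
          rw [ht]
          push_cast
          ring
      _ ≤ (1 - t) ^ 2 * (1 + t) := by gcongr
      -- (1-t)²(1+t) = (1-t)(1-t²).
      _ ≤ 1 := by nlinarith [mul_nonneg ht0 ht1, mul_nonneg (mul_nonneg ht0 ht0) ht1]

lemma sum_range_inv_sqrt_le (N : ℕ) :
    ∑ n ∈ Finset.range N, 1 / √((n : ℝ) + 1) ≤ 2 * √N := by
  induction N with
  | zero => simp
  | succ N ih =>
    rw [Finset.sum_range_succ]
    have hN : (0 : ℝ) ≤ N := Nat.cast_nonneg N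
    have hpos : 0 < √((N : ℝ) + 1) := Real.sqrt_pos.2 (by positivity)
    have h1 := Real.sq_sqrt hN
    have h2 := Real.sq_sqrt (show (0 : ℝ) ≤ (N : ℝ) + 1 by positivity)
    have : 1 / √((N : ℝ) + 1) ≤ 2 * √((N : ℝ) + 1) - 2 * √N := by
      rw [div_le_iff₀ hpos]
      nlinarith [sq_nonneg (√((N : ℝ) + 1) - √N)]
    push_cast
    linarith

/-- A rate of decay of the row energies of `green a b (1 - a - b)`. -/
noncomputable def greenDecayRate (a b : ℝ) : ℝ := (1 - b) * (a + b) * (1 - a) ^ 4 / 256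

lemma greenDecayRate_pos (hα1 : α < 1) (hβ1 : β < 1) (hαβ : 0 < α + β) :
    0 < greenDecayRate α β :=
  div_pos (mul_pos (mul_pos (sub_pos.2 hβ1) hαβ) (pow_pos (sub_pos.2 hα1) 4)) (by norm_num)

lemma greenDecayRate_le_one (hα : 0 ≤ α) (hα1 : α < 1) (hβ : 0 ≤ β) (hβ1 : β < 1) :
    greenDecayRate α β ≤ 1 := by
  have h1 : (1 - α) ^ 4 ≤ 1 := pow_le_one₀ (by linarith) (by linarith)
  have h2 : (1 - β) * (α + β) ≤ 1 * 2 :=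
    mul_le_mul (by linarith) (by linarith) (add_nonneg hα hβ) zero_le_one
  have h3 : (1 - β) * (α + β) * (1 - α) ^ 4 ≤ 2 * 1 :=
    mul_le_mul (by linarith) h1 (by positivity) (by norm_num)
  unfold greenDecayRate
  linarith

lemma sum_green_sq_le (hα : 0 ≤ α) (hα1 : α < 1) (hβ : 0 ≤ β) (hβ1 : β < 1)
    (hαβ : 0 < α + β) (K L : ℕ) :
    ∑ m ∈ Finset.range K, ∑ n ∈ Finset.range L, green α β (1 - α - β) (m + 1) (n + 1) ^ 2 ≤
      2 / ((1 - α) ^ 2 * √(greenDecayRate α β)) * √L := by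
  set κ := greenDecayRate α β with hκ
  have hκ0 : 0 < κ := greenDecayRate_pos hα1 hβ1 hαβ
  have hκ1 : κ ≤ 1 := greenDecayRate_le_one hα hα1 hβ hβ1
  have hα' : 0 < 1 - α := by linarith
  have hβ' : 0 < 1 - β := by linarith
  set v : ℕ → ℕ → ℝ := fun n m => green α β (1 - α - β) m (n + 1) with hvdef
  have hv0 : ∀ n, v n 0 = 0 := fun n => green_zero_left _ _ _ _
  have hvpos : ∀ n m, 0 ≤ v n m := fun n m => green_nonneg hα hα1.le hβ hβ1.le _ _
  -- The quantity v(m+1) - αv(m) is the input driving a row; for the first row it is the unit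
  -- impulse, so energy and mass start at most 1. Cutting at K only adds boundary terms of
  -- favourable sign.
  have hrec0 : ∀ m, v 0 (m + 1) - α * v 0 m = if m = 0 then 1 else 0 := by
    intro m
    simp only [hvdef, green_succ_succ, green_zero_right, and_true]
    ring
  have hrec : ∀ n m, v (n + 1) (m + 1) - α * v (n + 1) m =
      β * v n (m + 1) + (1 - α - β) * v n m := by
    intro n m
    simp only [hvdef]
    rw [green_succ_succ]
    simp
    ring
  set F : ℕ → ℝ := fun n => ∑ m ∈ Finset.range K, (v n (m + 1) - α * v n m) ^ 2 with hFdef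
  have hF : ∀ n, 0 ≤ F n := fun n => Finset.sum_nonneg fun _ _ => sq_nonneg _
  have hF0 : F 0 ≤ 1 := by
    simp only [hFdef, hrec0, ite_pow, zero_pow two_ne_zero, Finset.sum_ite_eq', one_pow]
    split_ifs <;> norm_num
  have hmass : ∀ n, ∑ m ∈ Finset.range K, (v n (m + 1) - α * v n m) ≤ 1 := by
    intro n
    induction n with
    | zero =>
      simp only [hrec0, Finset.sum_ite_eq']
      split_ifs <;> norm_num
    | succ n ih =>
      simp only [hrec]
      rw [sum_range_next_row α β (v n) (hv0 n)]
      linarith [mul_nonneg hβ'.le (hvpos n K)]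
  have hM : ∀ n, (1 - α) * ∑ m ∈ Finset.range K, v n (m + 1) ≤ 1 := by
    intro n
    have h := hmass n
    rw [sum_range_sub_mul α (v n) (hv0 n)] at h
    linarith [mul_nonneg hα (hvpos n K)]
  have hstep : ∀ n, F (n + 1) ≤ F n - κ * F n ^ 3 := by
    intro n
    have henergy : F (n + 1) ≤ F n -
        (1 - β) * (α + β) * ∑ m ∈ Finset.range K, (v n (m + 1) - v n m) ^ 2 := by
      simp only [hFdef, hrec]
      rw [sum_range_sq_next_row α β (v n) (hv0 n)]
      linarith [mul_nonneg (mul_nonneg hβ'.le hα'.le) (sq_nonneg (v n K))]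
    have hnash := sum_range_sq_pow_three_le (v n) (hv0 n) (hvpos n) K
    have hFE : F n ≤ 4 * ∑ m ∈ Finset.range K, v n (m + 1) ^ 2 :=
      sum_range_sq_sub_mul_le hα hα1.le (v n) (hv0 n) K
    have hMn := hM n
    have hM0 : 0 ≤ ∑ m ∈ Finset.range K, v n (m + 1) := Finset.sum_nonneg fun _ _ => hvpos _ _
    generalize ∑ m ∈ Finset.range K, v n (m + 1) ^ 2 = E at hnash hFE
    generalize ∑ m ∈ Finset.range K, v n (m + 1) = M at hnash hMn hM0
    have hD0 : 0 ≤ ∑ m ∈ Finset.range K, (v n (m + 1) - v n m) ^ 2 :=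
      Finset.sum_nonneg fun _ _ => sq_nonneg _
    generalize ∑ m ∈ Finset.range K, (v n (m + 1) - v n m) ^ 2 = D at hnash henergy hD0
    -- 256 = 4³·4, from F ≤ 4E cubed and the Nash constant; (1-α)⁴ absorbs M⁴.
    have hD : (1 - α) ^ 4 * F n ^ 3 ≤ 256 * D := by
      calc (1 - α) ^ 4 * F n ^ 3 ≤ (1 - α) ^ 4 * (4 * E) ^ 3 := by
            have := pow_le_pow_left₀ (hF n) hFE 3
            gcongr
        _ = 64 * (1 - α) ^ 4 * E ^ 3 := by ring
        _ ≤ 64 * (1 - α) ^ 4 * (4 * M ^ 4 * D) := by gcongr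
        _ = 256 * D * ((1 - α) * M) ^ 4 := by ring
        _ ≤ 256 * D * 1 := by
            have := pow_le_one₀ (n := 4) (by positivity) hMn
            gcongr
        _ = 256 * D := mul_one _
    have hκD : κ * F n ^ 3 ≤ (1 - β) * (α + β) * D := by
      calc κ * F n ^ 3 = (1 - β) * (α + β) / 256 * ((1 - α) ^ 4 * F n ^ 3) := by
            rw [hκ, greenDecayRate]
            ring
        _ ≤ (1 - β) * (α + β) / 256 * (256 * D) := by gcongr
        _ = _ := by ring
    linarith
  have hdecay : ∀ n : ℕ, F n ≤ 1 / √κ * (1 / √((n : ℝ) + 1)) := by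
    intro n
    have h := sq_mul_le_one_of_le_sub_cube hκ0.le hF hF0 hstep n
    -- κ ≤ 1 gives κ(n+1) ≤ 1 + κn.
    have hle : (F n * √(κ * ((n : ℝ) + 1))) ^ 2 ≤ 1 := by
      rw [mul_pow, Real.sq_sqrt (by positivity)]
      refine le_trans ?_ h
      gcongr
      linarith
    have h1 : F n * √(κ * ((n : ℝ) + 1)) ≤ 1 :=
      (sq_le_one_iff₀ (mul_nonneg (hF n) (Real.sqrt_nonneg _))).1 hle
    rw [one_div_mul_one_div, ← Real.sqrt_mul hκ0.le, le_div_iff₀ (Real.sqrt_pos.2 (by positivity))]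
    exact h1
  rw [Finset.sum_comm]
  calc ∑ n ∈ Finset.range L, ∑ m ∈ Finset.range K, v n (m + 1) ^ 2
      ≤ ∑ n ∈ Finset.range L, 1 / (1 - α) ^ 2 * (1 / √κ * (1 / √((n : ℝ) + 1))) := by
        refine Finset.sum_le_sum fun n _ => ?_
        rw [one_div_mul_eq_div, le_div_iff₀ (by positivity), mul_comm]
        exact (mul_sum_range_sq_le hα hα1.le (v n) (hv0 n) K).trans (hdecay n)
    _ = 1 / (1 - α) ^ 2 * (1 / √κ * ∑ n ∈ Finset.range L, 1 / √((n : ℝ) + 1)) := by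
        simp_rw [Finset.mul_sum]
    _ ≤ 1 / (1 - α) ^ 2 * (1 / √κ * (2 * √L)) := by
        have := sum_range_inv_sqrt_le L
        gcongr
    _ = _ := by
        have := Real.sqrt_pos.2 hκ0
        field_simp

end CriticalGreen

/-! ### Reduction of signs. -/

section Comparison

lemma abs_green_le_green_abs (α β γ : ℝ) (m n : ℕ) :
    |green α β γ m n| ≤ green |α| |β| |γ| m n := by
  induction m generalizing n with
  | zero => simp
  | succ m ihm =>
    induction n with
    | zero => simp
    | succ n ihn =>
      rw [green_succ_succ, green_succ_succ]
      have hind : |(if m = 0 ∧ n = 0 then (1 : ℝ) else 0)| ≤ if m = 0 ∧ n = 0 then 1 else 0 := by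
        split_ifs <;> simp
      refine (abs_add_le _ _).trans (add_le_add ((abs_add_le _ _).trans
        (add_le_add ((abs_add_le _ _).trans (add_le_add ?_ ?_)) ?_)) hind)
      · rw [abs_mul]
        exact mul_le_mul_of_nonneg_left (ihm _) (abs_nonneg _)
      · rw [abs_mul]
        exact mul_le_mul_of_nonneg_left ihn (abs_nonneg _)
      · rw [abs_mul]
        exact mul_le_mul_of_nonneg_left (ihm _) (abs_nonneg _)

/-- The natural exponents are m-1 and n-1, the displacement from (1, 1); m+1 and n+1 have the same
parity and avoid subtraction. -/
lemma green_sign_mul {σ τ : ℝ} (hσ : σ ^ 2 = 1) (hτ : τ ^ 2 = 1) (α β γ : ℝ) (m n : ℕ) :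
    green (σ * α) (τ * β) (σ * τ * γ) m n = σ ^ (m + 1) * τ ^ (n + 1) * green α β γ m n := by
  induction m generalizing n with
  | zero => simp
  | succ m ihm =>
    induction n with
    | zero => simp
    | succ n ihn =>
      rw [green_succ_succ, green_succ_succ, ihm, ihm, ihn]
      split_ifs with h
      · obtain ⟨rfl, rfl⟩ := h
        simp [hσ, hτ]
      · ring

lemma abs_green_le_green_of_critical {α β γ : ℝ} (hα1 : |α| ≤ 1) (hβ1 : |β| ≤ 1)
    (hpos : 0 ≤ α * β * γ → |α| + |β| + |γ| = 1)
    (hneg : α * β * γ < 0 → |α| + |β| - |γ| = 1) (m n : ℕ) :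
    |green α β γ m n| ≤ green |α| |β| (1 - |α| - |β|) m n := by
  rcases le_or_gt 0 (α * β * γ) with h | h
  · rw [show 1 - |α| - |β| = |γ| by linarith [hpos h]]
    exact abs_green_le_green_abs α β γ m n
  -- Making α and β positive turns γ into -|γ| = 1-|α|-|β|; the triangle inequality would lose this
  -- cancellation.
  · have hα : α ≠ 0 := by rintro rfl; simp at h
    have hβ : β ≠ 0 := by rintro rfl; simp at h
    obtain ⟨σ, hσ, hσα⟩ : ∃ σ : ℝ, |σ| = 1 ∧ α = σ * |α| := by
      rcases abs_choice α with h | h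
      · exact ⟨1, by simp, by rw [h]; ring⟩
      · exact ⟨-1, by simp, by rw [h]; ring⟩
    obtain ⟨τ, hτ, hτβ⟩ : ∃ τ : ℝ, |τ| = 1 ∧ β = τ * |β| := by
      rcases abs_choice β with h | h
      · exact ⟨1, by simp, by rw [h]; ring⟩
      · exact ⟨-1, by simp, by rw [h]; ring⟩
    have hσ2 : σ ^ 2 = 1 := by rw [← sq_abs, hσ, one_pow]
    have hτ2 : τ ^ 2 = 1 := by rw [← sq_abs, hτ, one_pow]
    have hsign : σ * τ * γ < 0 := by
      have hpos : 0 < |α| * |β| := by positivity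
      have : α * β * γ = |α| * |β| * (σ * τ * γ) := by
        conv_lhs => rw [hσα, hτβ]
        ring
      rw [this] at h
      exact neg_of_mul_neg_right h hpos.le
    have habs : |σ * τ * γ| = |γ| := by rw [abs_mul, abs_mul, hσ, hτ, one_mul, one_mul]
    have hγ : γ = σ * τ * (1 - |α| - |β|) := by
      rw [abs_of_neg hsign] at habs
      have hval : 1 - |α| - |β| = σ * τ * γ := by linarith [hneg h]
      rw [hval]
      linear_combination (-γ) * (σ ^ 2 * hτ2 + hσ2)
    have hnn : |green |α| |β| (1 - |α| - |β|) m n| = green |α| |β| (1 - |α| - |β|) m n :=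
      abs_of_nonneg (green_nonneg (abs_nonneg α) hα1 (abs_nonneg β) hβ1 m n)
    have := green_sign_mul hσ2 hτ2 |α| |β| (1 - |α| - |β|) m n
    rw [← hσα, ← hτβ, ← hγ] at this
    rw [this, abs_mul, abs_mul, abs_pow, abs_pow, hσ, hτ, hnn]
    simp

end Comparison

/-! ### Critical covariance bound and assembly. -/

lemma sum_range_add_le_sum_range {f : ℕ → ℕ → ℝ} (hf : ∀ m n, 0 ≤ f m n) (a p b q : ℕ) :
    ∑ m ∈ Finset.range p, ∑ n ∈ Finset.range q, f (a + m) (b + n) ≤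
      ∑ m ∈ Finset.range (a + p), ∑ n ∈ Finset.range (b + q), f m n := by
  have h1 : ∀ m, ∑ n ∈ Finset.range q, f m (b + n) ≤ ∑ n ∈ Finset.range (b + q), f m n := by
    intro m
    rw [Finset.sum_range_add (f m)]
    exact le_add_of_nonneg_left (Finset.sum_nonneg fun _ _ => hf _ _)
  rw [Finset.sum_range_add (fun m => ∑ n ∈ Finset.range (b + q), f m n)]
  exact (Finset.sum_le_sum fun m _ => h1 _).trans (le_add_of_nonneg_left
    (Finset.sum_nonneg fun _ _ => Finset.sum_nonneg fun _ _ => hf _ _))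

lemma abs_covariance_le_of_critical {Ω : Type*} [MeasurableSpace Ω] (P : Measure Ω)
    [IsProbabilityMeasure P] {ε : ℕ+ → ℕ+ → Ω → ℝ} (hε : IsUnitNoise P ε) {α β γ : ℝ}
    (hα1 : |α| < 1) (hβ1 : |β| < 1) (hγ1 : |γ| < 1)
    (hpos : 0 ≤ α * β * γ → |α| + |β| + |γ| = 1)
    (hneg : α * β * γ < 0 → |α| + |β| - |γ| = 1) (k₁ l₁ k₂ l₂ : ℕ) :
    |covariance (spatialAR α β γ ε k₁ l₁) (spatialAR α β γ ε k₂ l₂) P| ≤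
      2 / ((1 - |α|) ^ 2 * √(greenDecayRate |α| |β|)) * √((k₁ : ℝ) + l₁ + k₂ + l₂) := by
  have hαβ : 0 < |α| + |β| := by
    rcases le_or_gt 0 (α * β * γ) with h | h
    · linarith [hpos h]
    · linarith [hneg h, abs_nonneg γ]
  have hcomp := abs_green_le_green_of_critical hα1.le hβ1.le hpos hneg
  set u := green |α| |β| (1 - |α| - |β|)
  set C := 2 / ((1 - |α|) ^ 2 * √(greenDecayRate |α| |β|)) with hC
  have hC0 : 0 ≤ C := by positivity
  have hrow : ∀ a p b q : ℕ, b + q ≤ l₁ + l₂ → ∑ m ∈ Finset.range p, ∑ n ∈ Finset.range q,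
      u (a + m + 1) (b + n + 1) ^ 2 ≤ C * √((k₁ : ℝ) + l₁ + k₂ + l₂) := by
    intro a p b q hbq
    refine (sum_range_add_le_sum_range (f := fun m n => u (m + 1) (n + 1) ^ 2)
      (fun _ _ => sq_nonneg _) a p b q).trans ((sum_green_sq_le (abs_nonneg α) hα1 (abs_nonneg β)
      hβ1 hαβ (a + p) (b + q)).trans (mul_le_mul_of_nonneg_left (Real.sqrt_le_sqrt ?_) hC0))
    have h : ((b + q : ℕ) : ℝ) ≤ (l₁ + l₂ : ℕ) := Nat.cast_le.2 hbq
    rw [Nat.cast_add l₁ l₂] at h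
    linarith [Nat.cast_nonneg (α := ℝ) k₁, Nat.cast_nonneg (α := ℝ) k₂]
  rw [covariance_spatialAR α β γ P hε]
  have h1 := hrow (k₁ - min k₁ k₂) (min k₁ k₂) (l₁ - min l₁ l₂) (min l₁ l₂) (by omega)
  have h2 := hrow (k₂ - min k₁ k₂) (min k₁ k₂) (l₂ - min l₁ l₂) (min l₁ l₂) (by omega)
  generalize k₁ - min k₁ k₂ = a₁ at *
  generalize k₂ - min k₁ k₂ = a₂ at *
  generalize l₁ - min l₁ l₂ = b₁ at *
  generalize l₂ - min l₁ l₂ = b₂ at *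
  generalize min k₁ k₂ = p at *
  generalize min l₁ l₂ = q at *
  -- By 2xy ≤ x² + y², only sums of squares over the two shifted windows remain.
  calc _ ≤ ∑ m ∈ Finset.range p, ∑ n ∈ Finset.range q,
        (u (a₁ + m + 1) (b₁ + n + 1) ^ 2 / 2 + u (a₂ + m + 1) (b₂ + n + 1) ^ 2 / 2) := by
        refine (Finset.abs_sum_le_sum_abs _ _).trans (Finset.sum_le_sum fun m _ => ?_)
        refine (Finset.abs_sum_le_sum_abs _ _).trans (Finset.sum_le_sum fun n _ => ?_)
        rw [abs_mul]
        refine (mul_le_mul (hcomp _ _) (hcomp _ _) (abs_nonneg _)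
          ((abs_nonneg _).trans (hcomp _ _))).trans ?_
        linarith [two_mul_le_add_sq (u (a₁ + m + 1) (b₁ + n + 1)) (u (a₂ + m + 1) (b₂ + n + 1))]
    _ = (∑ m ∈ Finset.range p, ∑ n ∈ Finset.range q, u (a₁ + m + 1) (b₁ + n + 1) ^ 2) / 2 +
        (∑ m ∈ Finset.range p, ∑ n ∈ Finset.range q, u (a₂ + m + 1) (b₂ + n + 1) ^ 2) / 2 := by
        simp_rw [Finset.sum_add_distrib, Finset.sum_div]
    _ ≤ _ := by linarith

lemma eq_neg_mul_of_abs_eq {α β γ : ℝ} (h : α * β * γ ≤ 0) (habs : |γ| = |α * β|) :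
    γ = -(α * β) := by
  rcases abs_eq_abs.1 habs with h' | h'
  -- If γ = αβ, the sign condition reads γ² ≤ 0.
  · have h0 : γ = 0 := by
      rw [← h'] at h
      exact mul_self_eq_zero.1 (le_antisymm h (mul_self_nonneg γ))
    rw [← h', h0, neg_zero]
  · exact h'

theorem theorem2 :
    ∃ C : ℝ → ℝ → ℝ, (∀ a b : ℝ, 0 < C a b) ∧
      ∀ (Ω : Type*) [MeasurableSpace Ω] (P : Measure Ω) [IsProbabilityMeasure P]
        (ε : ℕ+ → ℕ+ → Ω → ℝ), IsUnitNoise P ε →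
      ∀ (α β γ : ℝ) (k₁ l₁ k₂ l₂ : ℕ),
        (|α| + |β| + |γ| < 1 →
          |covariance (spatialAR α β γ ε k₁ l₁) (spatialAR α β γ ε k₂ l₂) P| ≤
            (|α| + |β| + |γ|) ^ (((absDiff k₁ k₂ : ℝ) + (absDiff l₁ l₂ : ℝ)) / 2) /
              (1 - (|α| + |β| + |γ|)) ^ 2) ∧
        (|α| < 1 → |β| < 1 → |γ| < 1 →
          (0 ≤ α * β * γ → |α| + |β| + |γ| = 1) →
          (α * β * γ < 0 → |α| + |β| - |γ| = 1) →
          |covariance (spatialAR α β γ ε k₁ l₁) (spatialAR α β γ ε k₂ l₂) P| ≤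
            C α β * √((k₁ : ℝ) + l₁ + k₂ + l₂)) ∧
        (α * β * γ ≤ 0 → |α| = 1 → |β| = |γ| → |γ| < 1 →
          |covariance (spatialAR α β γ ε k₁ l₁) (spatialAR α β γ ε k₂ l₂) P| ≤
            (min k₁ k₂ : ℕ) * (|γ| ^ absDiff l₁ l₂ / (1 - γ ^ 2))) ∧
        (α * β * γ ≤ 0 → |β| = 1 → |α| = |γ| → |γ| < 1 →
          |covariance (spatialAR α β γ ε k₁ l₁) (spatialAR α β γ ε k₂ l₂) P| ≤
            (min l₁ l₂ : ℕ) * (|γ| ^ absDiff k₁ k₂ / (1 - γ ^ 2))) ∧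
        (α * β * γ = -1 → |α| = 1 → |β| = 1 → |γ| = 1 →
          covariance (spatialAR α β γ ε k₁ l₁) (spatialAR α β γ ε k₂ l₂) P =
            (min k₁ k₂ : ℕ) * (min l₁ l₂ : ℕ) * α ^ absDiff k₁ k₂ * β ^ absDiff l₁ l₂) := by
  -- Positivity is required for all a, b. Adding 1 covers those where the denominator vanishes and
  -- the quotient takes the default value 0.
  refine ⟨fun a b => 2 / ((1 - |a|) ^ 2 * √(greenDecayRate |a| |b|)) + 1,
    fun a b => by positivity, ?_⟩
  intro Ω _ P _ ε hε α β γ k₁ l₁ k₂ l₂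
  refine ⟨fun h => abs_covariance_le_of_sum_lt_one P hε h k₁ l₁ k₂ l₂,
    fun hα hβ hγ hpos hneg => ?_, fun h hα hβγ hγ => ?_, fun h hβ hαγ hγ => ?_,
    fun h hα hβ hγ => ?_⟩
  · refine (abs_covariance_le_of_critical P hε hα hβ hγ hpos hneg k₁ l₁ k₂ l₂).trans ?_
    exact mul_le_mul_of_nonneg_right (le_add_of_nonneg_right zero_le_one) (Real.sqrt_nonneg _)
  · have hfac := eq_neg_mul_of_abs_eq h (by rw [abs_mul, hα, one_mul, hβγ])
    rw [← sq_abs γ, ← hβγ, sq_abs]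
    exact abs_covariance_le_of_factorized_left P hε hfac hα (hβγ ▸ hγ) k₁ l₁ k₂ l₂
  · have hfac := eq_neg_mul_of_abs_eq h (by rw [abs_mul, hβ, mul_one, hαγ])
    rw [← sq_abs γ, ← hαγ, sq_abs]
    exact abs_covariance_le_of_factorized_right P hε hfac hβ (hαγ ▸ hγ) k₁ l₁ k₂ l₂
  · have hfac := eq_neg_mul_of_abs_eq (by rw [h]; norm_num) (by rw [abs_mul, hα, hβ, hγ, one_mul])
    exact covariance_eq_of_factorized_unit P hε hfac hα hβ k₁ l₁ k₂ l₂
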